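/- Let $\mathcal{P}_3$ be the three-qubit Pauli group, consisting of all unitary operators $i^{m}\,\sigma_1\otimes\sigma_2\otimes\sigma_3$ on $(\mathbb{C}^2)^{\otimes 3}$ with $m\in\{0,1,2,3\}$ and $\sigma_1,\sigma_2,\sigma_3\in\{I,X,Y,Z\}$. Put $\mathcal{C}_1=\mathcal{P}_3$ and, for $k\ge 1$, let $\mathcal{C}_{k+1}$ be the set of all unitary operators $U$ on $(\mathbb{C}^2)^{\otimes 3}$ with $U\,\mathcal{C}_1\,U^{\dagger}\subseteq\mathcal{C}_k$. Then every $U\in\mathcal{C}_3$ is semi-Clifford, that is, there is a maximal abelian subgroup $G$ of $\mathcal{P}_3$ such that $UGU^{\dagger}$ is also a maximal abelian subgroup of $\mathcal{P}_3$. -/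

import Mathlib

/-- The group of unitary operators on `n` qubits, written as matrices in the computational basis,
which is indexed by the bit strings of length `n`. In this group `U⁻¹` is the adjoint of `U`. -/
abbrev QubitUnitary (n : ℕ) : Type :=
  Matrix.unitaryGroup (Fin n → Fin 2) ℂ

/-- The one-qubit matrices `I, X, Y, Z`. -/
def pauliMatrix : Fin 4 → Matrix (Fin 2) (Fin 2) ℂ :=
  ![!![1, 0; 0, 1], !![0, 1; 1, 0], !![0, -Complex.I; Complex.I, 0], !![1, 0; 0, -1]]

/-- The tensor product `A 0 ⊗ ⋯ ⊗ A (n - 1)` of one-qubit matrices. -/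
def tensorMatrix {n : ℕ} (A : Fin n → Matrix (Fin 2) (Fin 2) ℂ) :
    Matrix (Fin n → Fin 2) (Fin n → Fin 2) ℂ :=
  Matrix.of fun x y => ∏ j, A j (x j) (y j)

/-- The tensor product of the one-qubit Pauli matrices named by `s`. -/
def pauliString {n : ℕ} (s : Fin n → Fin 4) :
    Matrix (Fin n → Fin 2) (Fin n → Fin 2) ℂ :=
  tensorMatrix fun j => pauliMatrix (s j)

theorem tensorMatrix_mul {n : ℕ} (A B : Fin n → Matrix (Fin 2) (Fin 2) ℂ) :
    tensorMatrix A * tensorMatrix B = tensorMatrix fun j => A j * B j := by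
  ext x y
  simp only [tensorMatrix, Matrix.mul_apply, Matrix.of_apply, ← Finset.prod_mul_distrib]
  rw [Finset.prod_univ_sum]
  simp

theorem tensorMatrix_smul {n : ℕ} (c : Fin n → ℂ) (A : Fin n → Matrix (Fin 2) (Fin 2) ℂ) :
    (tensorMatrix fun j => c j • A j) = (∏ j, c j) • tensorMatrix A := by
  ext x y
  simp [tensorMatrix, Finset.prod_mul_distrib]

theorem pauliMatrix_mul (a b : Fin 4) :
    ∃ (k : ℕ) (c : Fin 4), pauliMatrix a * pauliMatrix b = Complex.I ^ k • pauliMatrix c := by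
  have h3 : Complex.I ^ 3 = -Complex.I := Complex.I_pow_three
  have key : ∀ a b : Fin 4, pauliMatrix a * pauliMatrix b =
      Complex.I ^ ((![![0, 0, 0, 0], ![0, 0, 1, 3], ![0, 3, 0, 1], ![0, 1, 3, 0]] :
        Fin 4 → Fin 4 → ℕ) a b) •
      pauliMatrix ((![![0, 1, 2, 3], ![1, 0, 3, 2], ![2, 3, 0, 1], ![3, 2, 1, 0]] :
        Fin 4 → Fin 4 → Fin 4) a b) := by
    intro a b
    fin_cases a <;> fin_cases b <;> ext i j <;> fin_cases i <;> fin_cases j <;>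
      simp [pauliMatrix, Matrix.mul_apply, h3]
  exact ⟨_, _, key a b⟩

theorem pauliString_mul {n : ℕ} (s t : Fin n → Fin 4) :
    ∃ (k : ℕ) (u : Fin n → Fin 4),
      pauliString s * pauliString t = Complex.I ^ k • pauliString u := by
  choose k c h using pauliMatrix_mul
  refine ⟨∑ j, k (s j) (t j), fun j => c (s j) (t j), ?_⟩
  simp only [pauliString, tensorMatrix_mul, h, tensorMatrix_smul, Finset.prod_pow_eq_pow_sum]

theorem pauliString_zero (n : ℕ) : pauliString (0 : Fin n → Fin 4) = 1 := by
  ext x y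
  have h : ∀ a b : Fin 2, pauliMatrix 0 a b = if a = b then 1 else 0 := by
    intro a b
    fin_cases a <;> fin_cases b <;> simp [pauliMatrix]
  simp [pauliString, tensorMatrix, h, Matrix.one_apply, Finset.prod_ite_zero, funext_iff]

theorem pauliString_star {n : ℕ} (s : Fin n → Fin 4) : star (pauliString s) = pauliString s := by
  have h : ∀ (c : Fin 4) (a b : Fin 2),
      (starRingEnd ℂ) (pauliMatrix c a b) = pauliMatrix c b a := by
    intro c a b
    fin_cases c <;> fin_cases a <;> fin_cases b <;> simp [pauliMatrix]
  ext x y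
  simp [pauliString, tensorMatrix, Matrix.star_apply, h]

/-- The `n`-qubit Pauli group: all `i ^ k • (σ₁ ⊗ ⋯ ⊗ σₙ)` with each `σⱼ` one of `I, X, Y, Z`. -/
def pauliGroup (n : ℕ) : Subgroup (QubitUnitary n) where
  carrier := {U | ∃ (k : ℕ) (s : Fin n → Fin 4),
    (U : Matrix (Fin n → Fin 2) (Fin n → Fin 2) ℂ) = Complex.I ^ k • pauliString s}
  one_mem' := ⟨0, 0, by simp [pauliString_zero]⟩
  mul_mem' := by
    rintro U V ⟨k, s, hU⟩ ⟨l, t, hV⟩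
    obtain ⟨m, u, h⟩ := pauliString_mul s t
    refine ⟨k + l + m, u, ?_⟩
    rw [Submonoid.coe_mul, hU, hV, smul_mul_smul_comm, h, smul_smul, pow_add, pow_add]
  inv_mem' := by
    rintro U ⟨k, s, hU⟩
    refine ⟨3 * k, s, ?_⟩
    have h : ((U⁻¹ : QubitUnitary n) : Matrix (Fin n → Fin 2) (Fin n → Fin 2) ℂ)
        = star (U : Matrix (Fin n → Fin 2) (Fin n → Fin 2) ℂ) := rfl
    rw [h, hU, star_smul, pauliString_star, pow_mul, Complex.I_pow_three, star_pow]
    simp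

/-- The sets `C_k` of `n`-qubit gates: `C_1` is the Pauli group, and `C_{k+1}` consists of the
unitaries `U` with `U C_1 U† ⊆ C_k`. The numbering starts at `1`; the value at `0` is not used. -/
def cliffordHierarchy (n : ℕ) : ℕ → Set (QubitUnitary n)
  | 0 => ∅
  | 1 => (pauliGroup n : Set (QubitUnitary n))
  | k + 2 => {U | ∀ P ∈ pauliGroup n, U * P * U⁻¹ ∈ cliffordHierarchy n (k + 1)}

/-- `G` is a maximal abelian subgroup of the `n`-qubit Pauli group. -/
def IsMaximalAbelianPauli {n : ℕ} (G : Subgroup (QubitUnitary n)) : Prop :=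
  Maximal (fun H : Subgroup (QubitUnitary n) =>
    H ≤ pauliGroup n ∧ ∀ g ∈ H, ∀ h ∈ H, g * h = h * g) G

/-- `U` is semi-Clifford: `U G U†` is a maximal abelian subgroup of the Pauli group for at least
one maximal abelian subgroup `G` of the Pauli group. -/
def IsSemiClifford {n : ℕ} (U : QubitUnitary n) : Prop :=
  ∃ G : Subgroup (QubitUnitary n), IsMaximalAbelianPauli G ∧
    IsMaximalAbelianPauli (G.map (MulAut.conj U).toMonoidHom)

/-!
A gate `U` in the third level makes every `U W U†`, with `W` a Pauli matrix, a Clifford gate. Up to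
phases, `U W U†` therefore permutes the Pauli matrices by a symplectic involution `S v` of phase
space `(ZMod 2) ^ (2 n)`, where `v` is the point of `W`, and the `S v` commute with each other.
Write `N v = S v - 1`. These operators are self-adjoint for the symplectic form `ω`, commute and square
to zero.

The matrices `U W U†` span, so for every `x` some `C = U W' U†`, with point `u`, has a nonzero
coefficient at the Pauli matrix of `x`. Conjugation by another `U W U†` changes `C` only by a sign,
so `C` has nonzero coefficients on the whole orbit `{S v x}`. The points occurring in a Clifford gate
`C` differ by vectors orthogonal to `ker (N u)`, and such vectors lie in `ker (N u)`. So the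
differences `N v x = S v x - x` are orthogonal to each other: `ω (N v x) (N w x) = 0`
(`symplecticForm_nilpotentPart_nilpotentPart`). In other words `N v N w` is an alternating operator.

An alternating operator has even rank. If `N v N w` is nonzero, its rank is at least two, and
phase space contains two independent free cyclic modules over `K[s, t] / (s², t²)`, which takes
eight dimensions (`apply_apply_eq_zero_of_finrank_lt`). Three qubits have only six, so all products
`N v N w` vanish, and the span of the ranges of the `N v` is isotropic. A Lagrangian subspace `L`
containing it is fixed pointwise by all `S v`. A Pauli matrix with point in `L` thus commutes up to
sign with all `U W U†`, so its conjugate by `U†` commutes up to sign with all Pauli matrices and is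
a Pauli matrix itself. These conjugates form a Lagrangian subspace again, by counting, and
Lagrangian subspaces give maximal abelian subgroups of the Pauli group
(`isSemiClifford_of_lagrangian`).
-/

namespace QubitPauli

/-! ### Commuting self-adjoint square-zero operators -/

/-- If `s t` were nonzero, then the alternating form `B (s t x) y` would have rank at least two, and
each of two vectors `x, y` with `B (s t x) y ≠ 0` would generate a free module of rank one over
`K[s, t] / (s², t²)`. Their sum is direct, which needs eight dimensions. -/
theorem apply_apply_eq_zero_of_finrank_lt {K V : Type*} [Field K] [AddCommGroup V] [Module K V]
    [FiniteDimensional K V] (hdim : Module.finrank K V < 8) (B : LinearMap.BilinForm K V)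
    (hsymm : ∀ x y, B x y = B y x) (hnd : ∀ x, (∀ y, B x y = 0) → x = 0) (s t : V →ₗ[K] V)
    (hs : ∀ x, s (s x) = 0) (ht : ∀ x, t (t x) = 0) (hst : ∀ x, t (s x) = s (t x))
    (hBs : ∀ x y, B (s x) y = B x (s y)) (hBt : ∀ x y, B (t x) y = B x (t y))
    (halt : ∀ x, B (s x) (t x) = 0) (x : V) : s (t x) = 0 := by
  by_contra hx
  obtain ⟨y, hy⟩ : ∃ y, B (s (t x)) y ≠ 0 := by
    by_contra! h
    exact hx (hnd _ h)
  have hself : ∀ z, B (s (t z)) z = 0 := fun z => by rw [← hst, hBt, halt]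
  have hyx : B (s (t y)) x ≠ 0 := by
    rwa [hBs, hBt, hst, hsymm]
  have hpair : ∀ a b : K, a • s (t x) + b • s (t y) = 0 → a = 0 ∧ b = 0 := by
    intro a b h
    have h1 := congrArg (fun z => B z y) h
    have h2 := congrArg (fun z => B z x) h
    simp only [map_add, map_smul, LinearMap.add_apply, LinearMap.smul_apply, hself, smul_eq_mul,
      mul_zero, add_zero, zero_add, map_zero, LinearMap.zero_apply, mul_eq_zero, hy, hyx,
      or_false] at h1 h2
    exact ⟨h1, h2⟩
  have hli : LinearIndependent K
      ![x, s x, t x, s (t x), y, s y, t y, s (t y)] := by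
    rw [Fintype.linearIndependent_iff]
    intro g hg
    simp only [Fin.sum_univ_eight, Matrix.cons_val] at hg
    -- Applying `s t`, then `t`, `s` and the identity, isolates the coefficients two at a time.
    have h1 := congrArg (fun z => s (t z)) hg
    simp only [map_add, map_smul, hs, ht, hst, map_zero, smul_zero, add_zero] at h1
    obtain ⟨h0, h4⟩ := hpair _ _ h1
    have h2 := congrArg (fun z => t z) hg
    simp only [map_add, map_smul, ht, hst, map_zero, smul_zero, add_zero, zero_add, h0, h4,
      zero_smul] at h2
    obtain ⟨h1', h5⟩ := hpair _ _ h2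
    have h3 := congrArg (fun z => s z) hg
    simp only [map_add, map_smul, hs, map_zero, smul_zero, add_zero, zero_add, h0, h4,
      zero_smul] at h3
    obtain ⟨h2', h6⟩ := hpair _ _ h3
    simp only [h0, h4, h1', h5, h2', h6, zero_smul, add_zero, zero_add] at hg
    obtain ⟨h3', h7⟩ := hpair _ _ hg
    intro i
    fin_cases i <;> assumption
  have := hli.fintype_card_le_finrank
  simp only [Fintype.card_fin] at this
  omega

/-! ### Lagrangian subspaces -/

/-- Every isotropic subspace is contained in a Lagrangian one. -/
theorem exists_orthogonal_eq_self {K V : Type*} [Field K] [AddCommGroup V] [Module K V]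
    [FiniteDimensional K V] (B : LinearMap.BilinForm K V) (hB : B.IsAlt) (R : Submodule K V)
    (hR : R ≤ B.orthogonal R) : ∃ L : Submodule K V, R ≤ L ∧ B.orthogonal L = L := by
  obtain ⟨L, hRL, hL⟩ := exists_maximal_ge_of_wellFoundedGT
    (fun L : Submodule K V => L ≤ B.orthogonal L) R hR
  refine ⟨L, hRL, le_antisymm (fun x hx => ?_) hL.prop⟩
  have hsup : L ⊔ K ∙ x ≤ B.orthogonal (L ⊔ K ∙ x) := by
    intro y hy z hz
    obtain ⟨a, ha, b, hb, rfl⟩ := Submodule.mem_sup.1 hy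
    obtain ⟨c, hc, d, hd, rfl⟩ := Submodule.mem_sup.1 hz
    obtain ⟨b, rfl⟩ := Submodule.mem_span_singleton.1 hb
    obtain ⟨d, rfl⟩ := Submodule.mem_span_singleton.1 hd
    have h1 : B c a = 0 := hL.prop ha c hc
    have h2 : B c x = 0 := hx c hc
    have h3 : B x a = 0 := hB.isRefl _ _ (hx a ha)
    have h4 : B x x = 0 := hB x
    simp [h1, h2, h3, h4]
  exact hL.le_of_ge hsup le_sup_left
    (Submodule.mem_sup_right (Submodule.mem_span_singleton_self x))

/-! ### Phase space and its symplectic form -/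

/-- The phase space of `n` qubits: `(a, b)` at site `j` stands for the Pauli matrix `X ^ a Z ^ b` on
the `j`-th qubit, up to a phase. -/
abbrev PhaseSpace (n : ℕ) : Type := Fin n → ZMod 2 × ZMod 2

/-- The symplectic form on phase space; it records which Pauli matrices anticommute. -/
def symplecticForm (n : ℕ) : LinearMap.BilinForm (ZMod 2) (PhaseSpace n) :=
  LinearMap.mk₂ (ZMod 2) (fun v w => ∑ j, ((v j).1 * (w j).2 + (v j).2 * (w j).1))
    (fun v v' w => by
      rw [← Finset.sum_add_distrib]
      refine Finset.sum_congr rfl fun j _ => ?_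
      simp only [Pi.add_apply, Prod.fst_add, Prod.snd_add]
      ring)
    (fun c v w => by
      rw [Finset.smul_sum]
      refine Finset.sum_congr rfl fun j _ => ?_
      simp only [Pi.smul_apply, Prod.smul_fst, Prod.smul_snd, smul_eq_mul]
      ring)
    (fun v w w' => by
      rw [← Finset.sum_add_distrib]
      refine Finset.sum_congr rfl fun j _ => ?_
      simp only [Pi.add_apply, Prod.fst_add, Prod.snd_add]
      ring)
    (fun c v w => by
      rw [Finset.smul_sum]
      refine Finset.sum_congr rfl fun j _ => ?_
      simp only [Pi.smul_apply, Prod.smul_fst, Prod.smul_snd, smul_eq_mul]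
      ring)

theorem symplecticForm_apply {n : ℕ} (v w : PhaseSpace n) :
    symplecticForm n v w = ∑ j, ((v j).1 * (w j).2 + (v j).2 * (w j).1) := rfl

theorem symplecticForm_symm {n : ℕ} (v w : PhaseSpace n) :
    symplecticForm n v w = symplecticForm n w v := by
  simp only [symplecticForm_apply]
  exact Finset.sum_congr rfl fun j _ => by ring

theorem symplecticForm_isAlt (n : ℕ) : (symplecticForm n).IsAlt := by
  intro v
  rw [symplecticForm_apply]
  refine Finset.sum_eq_zero fun j _ => ?_
  rw [mul_comm, CharTwo.add_self_eq_zero]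

theorem eq_zero_of_symplecticForm_eq_zero {n : ℕ} (v : PhaseSpace n)
    (h : ∀ w, symplecticForm n v w = 0) : v = 0 := by
  funext j
  have h1 := h (Pi.single j (1, 0))
  have h2 := h (Pi.single j (0, 1))
  rw [symplecticForm_apply, Finset.sum_eq_single j
    (fun i _ hi => by simp [Pi.single_eq_of_ne hi]) (by simp)] at h1 h2
  simp only [Pi.single_eq_same, mul_zero, mul_one, zero_add, add_zero] at h1 h2
  exact Prod.ext h2 h1

theorem eq_of_symplecticForm_eq {n : ℕ} {v w : PhaseSpace n}
    (h : ∀ z, symplecticForm n z v = symplecticForm n z w) : v = w := by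
  refine sub_eq_zero.1 (eq_zero_of_symplecticForm_eq_zero _ fun z => ?_)
  rw [symplecticForm_symm, map_sub, h, sub_self]

theorem symplecticForm_nondegenerate (n : ℕ) : (symplecticForm n).Nondegenerate :=
  ⟨eq_zero_of_symplecticForm_eq_zero, fun v h =>
    eq_zero_of_symplecticForm_eq_zero v fun w => by rw [symplecticForm_symm, h]⟩

theorem finrank_phaseSpace (n : ℕ) : Module.finrank (ZMod 2) (PhaseSpace n) = 2 * n := by
  simp [Module.finrank_pi_fintype, mul_comm]

/-- The sign `(-1) ^ t`. -/
def sign (t : ZMod 2) : ℂ := if t = 0 then 1 else -1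

theorem sign_add (a b : ZMod 2) : sign (a + b) = sign a * sign b := by
  have h : ∀ t : ZMod 2, t = 0 ∨ t = 1 := by decide
  obtain rfl | rfl := h a <;> obtain rfl | rfl := h b <;> simp [sign, CharTwo.add_self_eq_zero]

theorem sign_injective : Function.Injective sign := by
  intro a b
  have h : ∀ t : ZMod 2, t = 0 ∨ t = 1 := by decide
  obtain rfl | rfl := h a <;> obtain rfl | rfl := h b <;> norm_num [sign]

theorem sign_sum {ι : Type*} (s : Finset ι) (f : ι → ZMod 2) :
    sign (∑ j ∈ s, f j) = ∏ j ∈ s, sign (f j) := by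
  classical
  induction s using Finset.induction_on with
  | empty => simp [sign]
  | insert j s hj ih => rw [Finset.sum_insert hj, Finset.prod_insert hj, sign_add, ih]

/-! ### Pauli matrices labelled by phase space -/

/-- The label, in the numbering `I, X, Y, Z`, of the Pauli matrix `X ^ a Z ^ b` up to a phase. -/
def siteIndex (a : ZMod 2 × ZMod 2) : Fin 4 :=
  (![![0, 3], ![1, 2]] : Fin 2 → Fin 2 → Fin 4) a.1 a.2

/-- The Hermitian Pauli matrix of a point of phase space. -/
def pauli {n : ℕ} (v : PhaseSpace n) : Matrix (Fin n → Fin 2) (Fin n → Fin 2) ℂ :=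
  pauliString fun j => siteIndex (v j)

theorem siteIndex_surjective : Function.Surjective siteIndex := by
  decide

theorem exists_pauli_eq {n : ℕ} (s : Fin n → Fin 4) :
    ∃ v : PhaseSpace n, pauliString s = pauli v := by
  choose f hf using siteIndex_surjective
  exact ⟨fun j => f (s j), by simp [pauli, hf]⟩

theorem pauliMatrix_siteIndex_mul (a b : ZMod 2 × ZMod 2) :
    ∃ c : ℂ, c ≠ 0 ∧ pauliMatrix (siteIndex a) * pauliMatrix (siteIndex b) =
      c • pauliMatrix (siteIndex (a + b)) := by
  have key : ∀ a b : ZMod 2 × ZMod 2, pauliMatrix (siteIndex a) * pauliMatrix (siteIndex b) =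
      Complex.I ^ ((![![0, 0, 0, 0], ![0, 0, 1, 3], ![0, 3, 0, 1], ![0, 1, 3, 0]] :
        Fin 4 → Fin 4 → ℕ) (siteIndex a) (siteIndex b)) •
      pauliMatrix (siteIndex (a + b)) := by
    have h3 : Complex.I ^ 3 = -Complex.I := Complex.I_pow_three
    have hadd : ∀ a b : ZMod 2 × ZMod 2, siteIndex (a + b) =
      (![![0, 1, 2, 3], ![1, 0, 3, 2], ![2, 3, 0, 1], ![3, 2, 1, 0]] :
        Fin 4 → Fin 4 → Fin 4) (siteIndex a) (siteIndex b) := by decide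
    intro a b
    rw [hadd]
    generalize siteIndex a = p
    generalize siteIndex b = q
    fin_cases p <;> fin_cases q <;> ext i j <;> fin_cases i <;> fin_cases j <;>
      simp [pauliMatrix, Matrix.mul_apply, h3]
  exact ⟨_, pow_ne_zero _ Complex.I_ne_zero, key a b⟩

theorem pauliMatrix_siteIndex_comm (a b : ZMod 2 × ZMod 2) :
    pauliMatrix (siteIndex a) * pauliMatrix (siteIndex b) =
      sign (a.1 * b.2 + a.2 * b.1) • (pauliMatrix (siteIndex b) * pauliMatrix (siteIndex a)) := by
  have hcomm : ∀ a b : ZMod 2 × ZMod 2, a.1 * b.2 + a.2 * b.1 =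
      if siteIndex a = 0 ∨ siteIndex b = 0 ∨ siteIndex a = siteIndex b then 0 else 1 := by decide
  rw [hcomm]
  generalize siteIndex a = p
  generalize siteIndex b = q
  fin_cases p <;> fin_cases q <;> ext i j <;> fin_cases i <;> fin_cases j <;>
    simp [pauliMatrix, Matrix.mul_apply, sign]

theorem pauli_mul {n : ℕ} (v w : PhaseSpace n) :
    ∃ c : ℂ, c ≠ 0 ∧ pauli v * pauli w = c • pauli (v + w) := by
  choose c hc h using pauliMatrix_siteIndex_mul
  refine ⟨∏ j, c (v j) (w j), Finset.prod_ne_zero_iff.2 fun j _ => hc _ _, ?_⟩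
  simp only [pauli, pauliString, tensorMatrix_mul, h, tensorMatrix_smul, Pi.add_apply]

theorem pauli_comm {n : ℕ} (v w : PhaseSpace n) :
    pauli v * pauli w = sign (symplecticForm n v w) • (pauli w * pauli v) := by
  simp only [pauli, pauliString, tensorMatrix_mul, symplecticForm_apply, sign_sum,
    ← tensorMatrix_smul]
  congr 1
  funext j
  exact pauliMatrix_siteIndex_comm _ _

theorem pauli_zero (n : ℕ) : pauli (0 : PhaseSpace n) = 1 := by
  rw [← pauliString_zero]
  rfl

theorem pauli_mul_self {n : ℕ} (v : PhaseSpace n) : pauli v * pauli v = 1 := by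
  have h : ∀ c : Fin 4, pauliMatrix c * pauliMatrix c = pauliMatrix 0 := by
    intro c
    fin_cases c <;> ext i j <;> fin_cases i <;> fin_cases j <;>
      simp [pauliMatrix, Matrix.mul_apply]
  rw [← pauliString_zero]
  simp only [pauli, pauliString, tensorMatrix_mul, h]
  rfl

theorem star_pauli {n : ℕ} (v : PhaseSpace n) : star (pauli v) = pauli v :=
  pauliString_star _

/-- The Pauli matrix of a point of phase space, as a unitary. -/
def pauliUnitary {n : ℕ} (v : PhaseSpace n) : QubitUnitary n :=
  ⟨pauli v, Matrix.mem_unitaryGroup_iff.2 (by rw [star_pauli, pauli_mul_self])⟩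

theorem pauliUnitary_mem {n : ℕ} (v : PhaseSpace n) : pauliUnitary v ∈ pauliGroup n :=
  ⟨0, _, by rw [pow_zero, one_smul]; rfl⟩

/-- Completeness of the Pauli matrices, entry by entry. -/
theorem sum_pauli_mul_pauli {n : ℕ} (x y z w : Fin n → Fin 2) :
    ∑ v : PhaseSpace n, pauli v x y * pauli v z w = if x = w ∧ y = z then (2 : ℂ) ^ n else 0 := by
  have h : ∀ a b c d : Fin 2, ∑ s : ZMod 2 × ZMod 2,
      pauliMatrix (siteIndex s) a b * pauliMatrix (siteIndex s) c d =
        if a = d ∧ b = c then 2 else 0 := by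
    have hsum : ∀ f : Fin 4 → ℂ, ∑ s : ZMod 2 × ZMod 2, f (siteIndex s) = ∑ p, f p := fun f =>
      Fintype.sum_bijective siteIndex (by decide) _ _ fun _ => rfl
    intro a b c d
    have h0 : pauliMatrix 0 = !![1, 0; 0, 1] := rfl
    have h1 : pauliMatrix 1 = !![0, 1; 1, 0] := rfl
    have h2 : pauliMatrix 2 = !![0, -Complex.I; Complex.I, 0] := rfl
    have h3 : pauliMatrix 3 = !![1, 0; 0, -1] := rfl
    rw [hsum fun p => pauliMatrix p a b * pauliMatrix p c d, Fin.sum_univ_four, h0, h1, h2, h3]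
    fin_cases a <;> fin_cases b <;> fin_cases c <;> fin_cases d <;> norm_num
  simp only [pauli, pauliString, tensorMatrix, Matrix.of_apply, ← Finset.prod_mul_distrib]
  rw [← Fintype.prod_sum (fun j s => pauliMatrix (siteIndex s) (x j) (y j) *
    pauliMatrix (siteIndex s) (z j) (w j))]
  simp only [h, Finset.prod_ite_zero, Finset.mem_univ, forall_true_left, forall_and, funext_iff,
    Finset.prod_const, Finset.card_univ, Fintype.card_fin]

theorem sum_trace_smul_pauli {n : ℕ} (A : Matrix (Fin n → Fin 2) (Fin n → Fin 2) ℂ) :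
    ∑ v : PhaseSpace n, (A * pauli v).trace • pauli v = (2 : ℂ) ^ n • A := by
  ext z w
  simp only [Matrix.sum_apply, Matrix.smul_apply, Matrix.trace, Matrix.diag_apply,
    Matrix.mul_apply, smul_eq_mul, Finset.sum_mul, mul_assoc]
  rw [Finset.sum_comm]
  simp_rw [Finset.sum_comm (s := (Finset.univ : Finset (PhaseSpace n))), ← Finset.mul_sum,
    sum_pauli_mul_pauli]
  rw [Finset.sum_eq_single z, Finset.sum_eq_single w]
  · simp [mul_comm]
  · intro b _ hb
    simp [hb]
  · simp
  · intro b _ hb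
    refine Finset.sum_eq_zero fun c _ => ?_
    simp [hb]
  · simp

theorem exists_trace_mul_pauli_ne_zero {n : ℕ} {A : Matrix (Fin n → Fin 2) (Fin n → Fin 2) ℂ}
    (hA : A ≠ 0) : ∃ v : PhaseSpace n, (A * pauli v).trace ≠ 0 := by
  by_contra! h
  have := sum_trace_smul_pauli A
  simp only [h, zero_smul, Finset.sum_const_zero] at this
  exact smul_ne_zero (pow_ne_zero n two_ne_zero) hA this.symm

theorem pauli_ne_zero {n : ℕ} (v : PhaseSpace n) : pauli v ≠ 0 := by
  intro h
  have := pauli_mul_self v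
  rw [h, zero_mul] at this
  exact zero_ne_one this

/-! ### Equality up to a phase -/

/-- Equality of matrices up to a nonzero scalar. -/
def ProjEq {m : Type*} (A B : Matrix m m ℂ) : Prop := ∃ c : ℂ, c ≠ 0 ∧ A = c • B

namespace ProjEq

variable {m : Type*} {A B C D : Matrix m m ℂ}

theorem refl (A : Matrix m m ℂ) : ProjEq A A := ⟨1, one_ne_zero, (one_smul _ _).symm⟩

theorem symm (h : ProjEq A B) : ProjEq B A := by
  obtain ⟨c, hc, rfl⟩ := h
  exact ⟨c⁻¹, inv_ne_zero hc, by rw [smul_smul, inv_mul_cancel₀ hc, one_smul]⟩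

theorem trans (h : ProjEq A B) (h' : ProjEq B C) : ProjEq A C := by
  obtain ⟨c, hc, rfl⟩ := h
  obtain ⟨d, hd, rfl⟩ := h'
  exact ⟨c * d, mul_ne_zero hc hd, smul_smul _ _ _⟩

theorem mul [Fintype m] (h : ProjEq A B) (h' : ProjEq C D) : ProjEq (A * C) (B * D) := by
  obtain ⟨c, hc, rfl⟩ := h
  obtain ⟨d, hd, rfl⟩ := h'
  exact ⟨c * d, mul_ne_zero hc hd, smul_mul_smul_comm _ _ _ _⟩

theorem trace_ne_zero_iff [Fintype m] (h : ProjEq A B) : A.trace ≠ 0 ↔ B.trace ≠ 0 := by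
  obtain ⟨c, hc, rfl⟩ := h
  simp [hc]

end ProjEq

theorem projEq_pauli_mul {n : ℕ} (v w : PhaseSpace n) :
    ProjEq (pauli v * pauli w) (pauli (v + w)) := pauli_mul v w

theorem symplecticForm_eq_of_projEq {n : ℕ} {A B : Matrix (Fin n → Fin 2) (Fin n → Fin 2) ℂ}
    {v w : PhaseSpace n} {t : ZMod 2} (hA : ProjEq A (pauli v)) (hB : ProjEq B (pauli w))
    (h : A * B = sign t • (B * A)) : t = symplecticForm n v w := by
  obtain ⟨c, hc, rfl⟩ := hA
  obtain ⟨d, hd, rfl⟩ := hB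
  rw [smul_mul_smul_comm, smul_mul_smul_comm, pauli_comm, smul_smul, smul_smul,
    mul_comm d c] at h
  have hne : pauli w * pauli v ≠ 0 := by
    obtain ⟨e, he, h⟩ := pauli_mul w v
    rw [h]
    exact smul_ne_zero he (pauli_ne_zero _)
  have := smul_left_injective ℂ hne h
  rw [mul_comm] at this
  exact (sign_injective (mul_right_cancel₀ (mul_ne_zero hc hd) this)).symm

theorem eq_of_projEq_pauli {n : ℕ} {v w : PhaseSpace n} (h : ProjEq (pauli v) (pauli w)) :
    v = w :=
  eq_of_symplecticForm_eq fun z =>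
    symplecticForm_eq_of_projEq (ProjEq.refl (pauli z)) h (pauli_comm z v)

/-- The Pauli matrices occurring in a matrix that commutes with `pauli z` up to a phase have the
same commutation sign with `pauli z`. -/
theorem symplecticForm_eq_of_trace_ne_zero {n : ℕ}
    {A : Matrix (Fin n → Fin 2) (Fin n → Fin 2) ℂ} {z y y' : PhaseSpace n}
    (h : ProjEq (A * pauli z) (pauli z * A)) (hy : (A * pauli y).trace ≠ 0)
    (hy' : (A * pauli y').trace ≠ 0) : symplecticForm n z y = symplecticForm n z y' := by
  obtain ⟨c, -, hc⟩ := h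
  have key : ∀ y, (A * pauli y).trace ≠ 0 → sign (symplecticForm n z y) = c := by
    intro y hy
    have h1 : (A * pauli z * pauli y * pauli z).trace = c * (A * pauli y).trace := by
      rw [hc, smul_mul_assoc, smul_mul_assoc, Matrix.trace_smul, mul_assoc, mul_assoc,
        Matrix.trace_mul_comm, mul_assoc, mul_assoc, pauli_mul_self, mul_one, smul_eq_mul]
    have h2 : (A * pauli z * pauli y * pauli z).trace =
        sign (symplecticForm n z y) * (A * pauli y).trace := by
      rw [mul_assoc A, pauli_comm z y, mul_smul_comm, smul_mul_assoc, Matrix.trace_smul, mul_assoc,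
        mul_assoc (pauli y), pauli_mul_self, mul_one, smul_eq_mul]
    exact mul_right_cancel₀ hy (h2.symm.trans h1)
  exact sign_injective ((key y hy).trans (key y' hy').symm)

/-- A matrix that commutes with every Pauli matrix up to a phase contains a single Pauli matrix. -/
theorem exists_projEq_pauli {n : ℕ} {A : Matrix (Fin n → Fin 2) (Fin n → Fin 2) ℂ} (hA : A ≠ 0)
    (h : ∀ z : PhaseSpace n, ProjEq (A * pauli z) (pauli z * A)) :
    ∃ v : PhaseSpace n, ProjEq A (pauli v) := by
  obtain ⟨v, hv⟩ := exists_trace_mul_pauli_ne_zero hA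
  have hsum := sum_trace_smul_pauli A
  rw [Finset.sum_eq_single v] at hsum
  · have h2 : (2 : ℂ) ^ n ≠ 0 := pow_ne_zero n two_ne_zero
    exact ⟨v, (ProjEq.symm ⟨_, h2, hsum⟩).trans ⟨_, hv, rfl⟩⟩
  · intro w _ hw
    by_contra hne
    refine hw (eq_of_symplecticForm_eq fun z => ?_)
    exact symplecticForm_eq_of_trace_ne_zero (h z) (left_ne_zero_of_smul hne) hv
  · simp

/-! ### Conjugates of Pauli matrices by a gate in the third level -/

/-- The conjugate `U W U†` of the Pauli matrix `W` of the phase space point `v`. -/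
def conjPauli {n : ℕ} (U : QubitUnitary n) (v : PhaseSpace n) :
    Matrix (Fin n → Fin 2) (Fin n → Fin 2) ℂ :=
  U.1 * pauli v * star U.1

theorem conj_mul_conj {n : ℕ} (U : QubitUnitary n)
    (A B : Matrix (Fin n → Fin 2) (Fin n → Fin 2) ℂ) :
    (U.1 * A * star U.1) * (U.1 * B * star U.1) = U.1 * (A * B) * star U.1 := by
  have h : star U.1 * U.1 = 1 := Matrix.mem_unitaryGroup_iff'.1 U.2
  simp only [mul_assoc]
  rw [← mul_assoc (star U.1) U.1, h, one_mul]

theorem conjPauli_mul_self {n : ℕ} (U : QubitUnitary n) (v : PhaseSpace n) :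
    conjPauli U v * conjPauli U v = 1 := by
  rw [conjPauli, conj_mul_conj, pauli_mul_self, mul_one]
  exact Matrix.mem_unitaryGroup_iff.1 U.2

theorem conjPauli_comm {n : ℕ} (U : QubitUnitary n) (v w : PhaseSpace n) :
    conjPauli U v * conjPauli U w =
      sign (symplecticForm n v w) • (conjPauli U w * conjPauli U v) := by
  simp only [conjPauli]
  rw [conj_mul_conj, conj_mul_conj, pauli_comm, mul_smul_comm, smul_mul_assoc]

theorem sign_ne_zero (t : ZMod 2) : sign t ≠ 0 := by
  unfold sign
  split_ifs <;> norm_num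

theorem projEq_conjPauli_comm {n : ℕ} (U : QubitUnitary n) (v w : PhaseSpace n) :
    ProjEq (conjPauli U v * conjPauli U w) (conjPauli U w * conjPauli U v) :=
  ⟨_, sign_ne_zero _, conjPauli_comm U v w⟩

/-- `S v` is the symplectic map by which the Clifford gate `U W U†`, with `W` the Pauli matrix of
`v`, permutes the Pauli matrices up to phases. As `U W U†` is an involution, it is its own
inverse in this description. -/
def IsPhaseSpaceAction {n : ℕ} (U : QubitUnitary n)
    (S : PhaseSpace n → PhaseSpace n →ₗ[ZMod 2] PhaseSpace n) : Prop :=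
  ∀ v x, ProjEq (conjPauli U v * pauli x * conjPauli U v) (pauli (S v x))

theorem exists_isPhaseSpaceAction {n : ℕ} {U : QubitUnitary n} (hU : U ∈ cliffordHierarchy n 3) :
    ∃ S, IsPhaseSpaceAction U S := by
  have h : ∀ v x, ∃ y : PhaseSpace n,
      ProjEq (conjPauli U v * pauli x * conjPauli U v) (pauli y) := by
    intro v x
    obtain ⟨k, s, hs⟩ := hU _ (pauliUnitary_mem v) _ (pauliUnitary_mem x)
    obtain ⟨y, hy⟩ := exists_pauli_eq s
    refine ⟨y, Complex.I ^ k, pow_ne_zero _ Complex.I_ne_zero, ?_⟩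
    rw [← hy, ← hs]
    change _ = U.1 * pauli v * star U.1 * pauli x * star (U.1 * pauli v * star U.1)
    rw [conjPauli, star_mul, star_mul, star_pauli, star_star]
    simp only [mul_assoc]
  choose f hf using h
  have hadd : ∀ v x y, f v (x + y) = f v x + f v y := by
    intro v x y
    refine eq_of_projEq_pauli ((hf v (x + y)).symm.trans (.trans ?_ (projEq_pauli_mul _ _)))
    refine ProjEq.trans ?_ ((hf v x).mul (hf v y))
    have : conjPauli U v * pauli x * conjPauli U v * (conjPauli U v * pauli y * conjPauli U v) =
        conjPauli U v * (pauli x * pauli y) * conjPauli U v := by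
      simp only [mul_assoc]
      rw [← mul_assoc (conjPauli U v) (conjPauli U v), conjPauli_mul_self, one_mul]
    rw [this]
    exact ((ProjEq.refl _).mul (projEq_pauli_mul x y).symm).mul (ProjEq.refl _)
  exact ⟨fun v => (AddMonoidHom.mk' (f v) (hadd v)).toZModLinearMap 2, hf⟩

namespace IsPhaseSpaceAction

variable {n : ℕ} {U : QubitUnitary n} {S : PhaseSpace n → PhaseSpace n →ₗ[ZMod 2] PhaseSpace n}

theorem apply_apply (hS : IsPhaseSpaceAction U S) (v w x : PhaseSpace n) :
    ProjEq (conjPauli U v * conjPauli U w * pauli x * (conjPauli U w * conjPauli U v))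
      (pauli (S v (S w x))) := by
  have := ((ProjEq.refl (conjPauli U v)).mul (hS w x)).mul (ProjEq.refl (conjPauli U v))
  refine ProjEq.trans ?_ (this.trans (hS v (S w x)))
  simp only [mul_assoc]
  exact ProjEq.refl _

theorem involutive (hS : IsPhaseSpaceAction U S) (v x : PhaseSpace n) : S v (S v x) = x := by
  have := hS.apply_apply v v x
  rw [conjPauli_mul_self, one_mul, mul_one] at this
  exact (eq_of_projEq_pauli this).symm

theorem comm (hS : IsPhaseSpaceAction U S) (v w x : PhaseSpace n) :
    S v (S w x) = S w (S v x) :=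
  eq_of_projEq_pauli ((hS.apply_apply v w x).symm.trans
    ((((projEq_conjPauli_comm U v w).mul (ProjEq.refl _)).mul
      (projEq_conjPauli_comm U w v)).trans (hS.apply_apply w v x)))

theorem symplecticForm_apply_apply (hS : IsPhaseSpaceAction U S) (v x y : PhaseSpace n) :
    symplecticForm n (S v x) (S v y) = symplecticForm n x y := by
  refine (symplecticForm_eq_of_projEq (hS v x) (hS v y) ?_).symm
  have h : ∀ x y, conjPauli U v * pauli x * conjPauli U v *
      (conjPauli U v * pauli y * conjPauli U v) =
        conjPauli U v * (pauli x * pauli y) * conjPauli U v := by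
    intro x y
    simp only [mul_assoc]
    rw [← mul_assoc (conjPauli U v) (conjPauli U v), conjPauli_mul_self, one_mul]
  rw [h, h, pauli_comm, mul_smul_comm, smul_mul_assoc]

theorem symplecticForm_apply_left (hS : IsPhaseSpaceAction U S) (v x y : PhaseSpace n) :
    symplecticForm n (S v x) y = symplecticForm n x (S v y) := by
  rw [← hS.symplecticForm_apply_apply v x (S v y), hS.involutive]

/-- The nilpotent part `S v - 1`, written with `+` in characteristic two. -/
def nilpotentPart (S : PhaseSpace n → PhaseSpace n →ₗ[ZMod 2] PhaseSpace n) (v : PhaseSpace n) :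
    PhaseSpace n →ₗ[ZMod 2] PhaseSpace n :=
  S v + LinearMap.id

theorem nilpotentPart_apply (v x : PhaseSpace n) : nilpotentPart S v x = S v x + x := rfl

theorem add_self (x : PhaseSpace n) : x + x = 0 := by
  rw [← two_smul (ZMod 2) x, show (2 : ZMod 2) = 0 from rfl, zero_smul]

theorem nilpotentPart_eq_zero_iff {v x : PhaseSpace n} :
    nilpotentPart S v x = 0 ↔ S v x = x := by
  rw [nilpotentPart_apply, add_eq_zero_iff_eq_neg, neg_eq_of_add_eq_zero_left (add_self x)]

theorem nilpotentPart_nilpotentPart (hS : IsPhaseSpaceAction U S) (v x : PhaseSpace n) :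
    nilpotentPart S v (nilpotentPart S v x) = 0 := by
  simp only [nilpotentPart_apply, map_add, hS.involutive]
  rw [add_comm x, add_self]

theorem nilpotentPart_comm (hS : IsPhaseSpaceAction U S) (v w x : PhaseSpace n) :
    nilpotentPart S v (nilpotentPart S w x) = nilpotentPart S w (nilpotentPart S v x) := by
  simp only [nilpotentPart_apply, map_add, hS.comm v w]
  abel

theorem symplecticForm_nilpotentPart (hS : IsPhaseSpaceAction U S) (v x y : PhaseSpace n) :
    symplecticForm n (nilpotentPart S v x) y = symplecticForm n x (nilpotentPart S v y) := by
  simp only [nilpotentPart_apply, map_add, LinearMap.add_apply, hS.symplecticForm_apply_left]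

theorem projEq_comm_of_apply_eq (hS : IsPhaseSpaceAction U S) {v z : PhaseSpace n}
    (h : S v z = z) : ProjEq (conjPauli U v * pauli z) (pauli z * conjPauli U v) := by
  have := (hS v z).mul (ProjEq.refl (conjPauli U v))
  rwa [mul_assoc _ (conjPauli U v), conjPauli_mul_self, mul_one, h] at this

/-- If the Pauli matrix of `x` occurs in `U W U†`, so does that of `S v x`, since conjugation by
`conjPauli U v` preserves `conjPauli U u` up to sign. -/
theorem trace_apply_ne_zero (hS : IsPhaseSpaceAction U S) {u x : PhaseSpace n} (v : PhaseSpace n)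
    (h : (conjPauli U u * pauli x).trace ≠ 0) : (conjPauli U u * pauli (S v x)).trace ≠ 0 := by
  have h1 := (ProjEq.refl (conjPauli U u)).mul (hS v x)
  rw [← h1.trace_ne_zero_iff]
  have h2 : ProjEq (conjPauli U v * conjPauli U u * conjPauli U v * pauli x)
      (conjPauli U u * pauli x) := by
    refine ProjEq.mul ?_ (ProjEq.refl _)
    have := (projEq_conjPauli_comm U v u).mul (ProjEq.refl (conjPauli U v))
    rwa [mul_assoc (conjPauli U u), conjPauli_mul_self, mul_one] at this
  rw [← h2.trace_ne_zero_iff] at h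
  have h3 : (conjPauli U u * (conjPauli U v * pauli x * conjPauli U v)).trace =
      (conjPauli U v * conjPauli U u * conjPauli U v * pauli x).trace := by
    rw [← mul_assoc, Matrix.trace_mul_comm]
    simp only [mul_assoc]
  rwa [h3]

theorem exists_trace_ne_zero (U : QubitUnitary n) (x : PhaseSpace n) :
    ∃ u, (conjPauli U u * pauli x).trace ≠ 0 := by
  have hUU : U.1 * star U.1 = 1 := Matrix.mem_unitaryGroup_iff.1 U.2
  have hne : star U.1 * pauli x * U.1 ≠ 0 := by
    intro h
    have h1 : U.1 * (star U.1 * pauli x * U.1) * star U.1 = pauli x := by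
      rw [← mul_assoc, ← mul_assoc, hUU, one_mul, mul_assoc, hUU, mul_one]
    rw [h, mul_zero, zero_mul] at h1
    exact pauli_ne_zero x h1.symm
  obtain ⟨u, hu⟩ := exists_trace_mul_pauli_ne_zero hne
  refine ⟨u, ?_⟩
  have h : (conjPauli U u * pauli x).trace = (star U.1 * pauli x * U.1 * pauli u).trace := by
    rw [conjPauli, mul_assoc, Matrix.trace_mul_comm, ← mul_assoc]
  rwa [h]

/-- Some `conjPauli U u` contains the Pauli matrices of the whole orbit of `x`. The differences of
the phase space points occurring in it are orthogonal to the kernel of `nilpotentPart S u`, hence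
lie in that kernel, hence are orthogonal to each other. -/
theorem symplecticForm_nilpotentPart_nilpotentPart (hS : IsPhaseSpaceAction U S)
    (v w x : PhaseSpace n) :
    symplecticForm n (nilpotentPart S v x) (nilpotentPart S w x) = 0 := by
  obtain ⟨u, hu⟩ := exists_trace_ne_zero U x
  have horth : ∀ v z, nilpotentPart S u z = 0 → symplecticForm n z (nilpotentPart S v x) = 0 := by
    intro v z hz
    have := symplecticForm_eq_of_trace_ne_zero
      (hS.projEq_comm_of_apply_eq (nilpotentPart_eq_zero_iff.1 hz)) (hS.trace_apply_ne_zero v hu) hu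
    rw [nilpotentPart_apply, map_add, this, CharTwo.add_self_eq_zero]
  refine horth w _ (eq_zero_of_symplecticForm_eq_zero _ fun y => ?_)
  rw [hS.symplecticForm_nilpotentPart, symplecticForm_symm, horth v]
  exact hS.nilpotentPart_nilpotentPart u y

/-- For three qubits, products of two nilpotent parts are alternating on a space of dimension six,
and hence vanish. -/
theorem nilpotentPart_nilpotentPart_eq_zero {U : QubitUnitary 3}
    {S : PhaseSpace 3 → PhaseSpace 3 →ₗ[ZMod 2] PhaseSpace 3} (hS : IsPhaseSpaceAction U S)
    (v w x : PhaseSpace 3) : nilpotentPart S v (nilpotentPart S w x) = 0 :=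
  apply_apply_eq_zero_of_finrank_lt (by rw [finrank_phaseSpace]; norm_num) (symplecticForm 3)
    symplecticForm_symm eq_zero_of_symplecticForm_eq_zero _ _ (hS.nilpotentPart_nilpotentPart v)
    (hS.nilpotentPart_nilpotentPart w) (hS.nilpotentPart_comm w v)
    (hS.symplecticForm_nilpotentPart v) (hS.symplecticForm_nilpotentPart w)
    (hS.symplecticForm_nilpotentPart_nilpotentPart v w) x

/-- A Pauli matrix fixed by all `S v` commutes up to phases with all `U W U†`, so it is itself the
conjugate of a Pauli matrix. -/
theorem exists_projEq_of_forall_apply_eq (hS : IsPhaseSpaceAction U S) {x : PhaseSpace n}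
    (h : ∀ v, S v x = x) : ∃ u, ProjEq (conjPauli U u) (pauli x) := by
  have hUU : U.1 * star U.1 = 1 := Matrix.mem_unitaryGroup_iff.1 U.2
  have hUU' : star U.1 * U.1 = 1 := Matrix.mem_unitaryGroup_iff'.1 U.2
  have hback : U.1 * (star U.1 * pauli x * U.1) * star U.1 = pauli x := by
    rw [← mul_assoc, ← mul_assoc, hUU, one_mul, mul_assoc, hUU, mul_one]
  have hne : star U.1 * pauli x * U.1 ≠ 0 := by
    intro h
    rw [h, mul_zero, zero_mul] at hback
    exact pauli_ne_zero x hback.symm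
  obtain ⟨u, hu⟩ := exists_projEq_pauli hne fun z => by
    have := ((ProjEq.refl (star U.1)).mul (hS.projEq_comm_of_apply_eq (h z)).symm).mul
      (ProjEq.refl U.1)
    simp only [conjPauli, mul_assoc, hUU', mul_one] at this
    simp only [← mul_assoc, hUU', one_mul] at this
    simpa only [mul_assoc] using this
  refine ⟨u, ?_⟩
  have := ((ProjEq.refl U.1).mul hu.symm).mul (ProjEq.refl (star U.1))
  rwa [hback] at this

end IsPhaseSpaceAction

/-! ### Maximal abelian subgroups of the Pauli group -/

theorem exists_I_pow_of_pow_four_eq_one {c : ℂ} (hc : c ^ 4 = 1) : ∃ k : ℕ, c = Complex.I ^ k := by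
  have h : (c - 1) * (c + 1) * ((c - Complex.I) * (c + Complex.I)) = 0 := by
    have : (c - 1) * (c + 1) * ((c - Complex.I) * (c + Complex.I)) =
        (c ^ 2 - 1) * (c ^ 2 - Complex.I ^ 2) := by ring
    rw [this, Complex.I_sq]
    linear_combination hc
  rcases mul_eq_zero.1 h with h | h <;> rcases mul_eq_zero.1 h with h | h
  · exact ⟨0, by simpa using sub_eq_zero.1 h⟩
  · exact ⟨2, by rw [Complex.I_sq]; exact eq_neg_of_add_eq_zero_left h⟩
  · exact ⟨1, by simpa using sub_eq_zero.1 h⟩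
  · exact ⟨3, by rw [Complex.I_pow_three]; exact eq_neg_of_add_eq_zero_left h⟩

/-- The fourth-power condition singles out the phases `i ^ k`; unlike the explicit phase, it is
visibly preserved by conjugation. -/
theorem mem_pauliGroup_iff {n : ℕ} {P : QubitUnitary n} :
    P ∈ pauliGroup n ↔ P ^ 4 = 1 ∧ ∃ v, ProjEq P.1 (pauli v) := by
  have hpow : ∀ (c : ℂ) (v : PhaseSpace n), (c • pauli v) ^ 4 = c ^ 4 • (1 : Matrix _ _ ℂ) := by
    intro c v
    have h : pauli v ^ 4 = 1 := by
      rw [show 4 = 2 * 2 from rfl, pow_mul, pow_two (pauli v), pauli_mul_self, one_pow]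
    rw [smul_pow, h]
  constructor
  · rintro ⟨k, s, h⟩
    obtain ⟨v, hv⟩ := exists_pauli_eq s
    rw [hv] at h
    refine ⟨Subtype.ext ?_, v, _, pow_ne_zero _ Complex.I_ne_zero, h⟩
    change P.1 ^ 4 = 1
    rw [h, hpow, ← pow_mul, mul_comm, pow_mul, Complex.I_pow_four, one_pow, one_smul]
  · rintro ⟨h4, v, c, -, h⟩
    have h4' : P.1 ^ 4 = 1 := congrArg Subtype.val h4
    rw [h, hpow] at h4'
    have hc : c ^ 4 = 1 := by
      have := congrFun (congrFun h4' 0) 0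
      simpa using this
    obtain ⟨k, rfl⟩ := exists_I_pow_of_pow_four_eq_one hc
    exact ⟨k, _, h⟩

/-- The Pauli operators, with all phases `i ^ k`, whose phase space points lie in `L`. -/
def pauliSubgroup {n : ℕ} (L : Submodule (ZMod 2) (PhaseSpace n)) : Subgroup (QubitUnitary n) where
  carrier := {P | P ∈ pauliGroup n ∧ ∃ v ∈ L, ProjEq P.1 (pauli v)}
  one_mem' := ⟨one_mem _, 0, zero_mem _, by rw [pauli_zero]; exact ProjEq.refl _⟩
  mul_mem' := by
    rintro P Q ⟨hP, v, hv, h⟩ ⟨hQ, w, hw, h'⟩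
    exact ⟨mul_mem hP hQ, v + w, add_mem hv hw, (h.mul h').trans (projEq_pauli_mul v w)⟩
  inv_mem' := by
    rintro P ⟨hP, v, hv, c, hc, h⟩
    refine ⟨inv_mem hP, v, hv, star c, star_ne_zero.2 hc, ?_⟩
    change star P.1 = _
    rw [h, star_smul, star_pauli]

theorem pauliUnitary_mem_pauliSubgroup {n : ℕ} {L : Submodule (ZMod 2) (PhaseSpace n)}
    {v : PhaseSpace n} (hv : v ∈ L) : pauliUnitary v ∈ pauliSubgroup L :=
  ⟨pauliUnitary_mem v, v, hv, ProjEq.refl _⟩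

theorem mul_comm_iff_of_projEq {n : ℕ} {P Q : QubitUnitary n} {v w : PhaseSpace n}
    (hP : ProjEq P.1 (pauli v)) (hQ : ProjEq Q.1 (pauli w)) :
    P * Q = Q * P ↔ symplecticForm n v w = 0 := by
  constructor
  · intro h
    refine (symplecticForm_eq_of_projEq (t := 0) hP hQ ?_).symm
    rw [sign, if_pos rfl, one_smul]
    exact congrArg Subtype.val h
  · intro h
    obtain ⟨c, -, hc⟩ := hP
    obtain ⟨d, -, hd⟩ := hQ
    refine Subtype.ext ?_
    change P.1 * Q.1 = Q.1 * P.1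
    rw [hc, hd, smul_mul_smul_comm, smul_mul_smul_comm, pauli_comm, h, sign, if_pos rfl, one_smul,
      mul_comm c]

/-- Lagrangian subspaces give maximal abelian subgroups. -/
theorem isMaximalAbelianPauli_pauliSubgroup {n : ℕ} {L : Submodule (ZMod 2) (PhaseSpace n)}
    (hL : (symplecticForm n).orthogonal L = L) : IsMaximalAbelianPauli (pauliSubgroup L) := by
  refine ⟨⟨fun P hP => hP.1, ?_⟩, ?_⟩
  · rintro P ⟨-, v, hv, hPv⟩ Q ⟨-, w, hw, hQw⟩
    rw [mul_comm_iff_of_projEq hPv hQw]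
    rw [← hL] at hw
    exact hw v hv
  · rintro H ⟨hH, hcomm⟩ hle P hP
    obtain ⟨-, w, hw⟩ := mem_pauliGroup_iff.1 (hH hP)
    refine ⟨hH hP, w, ?_, hw⟩
    rw [← hL]
    intro v hv
    exact (mul_comm_iff_of_projEq (ProjEq.refl _) hw).1
      (hcomm _ (hle (pauliUnitary_mem_pauliSubgroup hv)) _ hP)

/-- If the Pauli matrices of a Lagrangian subspace `L` are conjugates by `U` of Pauli matrices, then
the latter also form a Lagrangian subspace, because they are as many. -/
theorem isSemiClifford_of_lagrangian {n : ℕ} {U : QubitUnitary n}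
    {L : Submodule (ZMod 2) (PhaseSpace n)} (hL : (symplecticForm n).orthogonal L = L)
    (h : ∀ x ∈ L, ∃ u, ProjEq (conjPauli U u) (pauli x)) : IsSemiClifford U := by
  let M : Submodule (ZMod 2) (PhaseSpace n) := AddSubgroup.toZModSubmodule 2
    { carrier := {u | ∃ x ∈ L, ProjEq (conjPauli U u) (pauli x)}
      zero_mem' := ⟨0, zero_mem _, by
        rw [conjPauli, pauli_zero, mul_one, Matrix.mem_unitaryGroup_iff.1 U.2]
        exact ProjEq.refl _⟩
      add_mem' := by
        rintro u v ⟨x, hx, hux⟩ ⟨y, hy, hvy⟩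
        refine ⟨x + y, add_mem hx hy, ProjEq.trans ?_ ((hux.mul hvy).trans (projEq_pauli_mul x y))⟩
        rw [conjPauli, conjPauli, conjPauli, conj_mul_conj]
        exact ((ProjEq.refl _).mul (projEq_pauli_mul u v).symm).mul (ProjEq.refl _)
      neg_mem' := by
        intro u hu
        rwa [eq_neg_of_add_eq_zero_left (IsPhaseSpaceAction.add_self u), neg_neg] }
  have hM : ∀ u, u ∈ M ↔ ∃ x ∈ L, ProjEq (conjPauli U u) (pauli x) := fun u => Iff.rfl
  have hiso : M ≤ (symplecticForm n).orthogonal M := by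
    intro v hv u hu
    obtain ⟨x, hx, hux⟩ := (hM u).1 hu
    obtain ⟨y, hy, hvy⟩ := (hM v).1 hv
    rw [symplecticForm_eq_of_projEq hux hvy (conjPauli_comm U u v)]
    rw [← hL] at hy
    exact hy x hx
  have hcard : Module.finrank (ZMod 2) L ≤ Module.finrank (ZMod 2) M := by
    choose f hf using h
    have hinj : Function.Injective fun x : L => (⟨f x x.2, (hM _).2 ⟨x, x.2, hf x x.2⟩⟩ : M) := by
      intro x y hxy
      have hxy' : f x x.2 = f y y.2 := congrArg Subtype.val hxy
      have := hf x x.2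
      rw [hxy'] at this
      exact Subtype.ext (eq_of_projEq_pauli (this.symm.trans (hf y y.2)))
    have := Nat.card_le_card_of_injective _ hinj
    rw [Module.natCard_eq_pow_finrank (K := ZMod 2), Module.natCard_eq_pow_finrank (K := ZMod 2)
      (V := M), Nat.card_zmod] at this
    exact (Nat.pow_le_pow_iff_right (by norm_num)).1 this
  have hMM : (symplecticForm n).orthogonal M = M := by
    refine (Submodule.eq_of_le_of_finrank_le hiso ?_).symm
    have h1 := LinearMap.BilinForm.finrank_orthogonal (symplecticForm_nondegenerate n) L
    have h2 := LinearMap.BilinForm.finrank_orthogonal (symplecticForm_nondegenerate n) M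
    rw [hL] at h1
    omega
  refine ⟨pauliSubgroup M, isMaximalAbelianPauli_pauliSubgroup hMM, ?_⟩
  have hmap : (pauliSubgroup M).map (MulAut.conj U).toMonoidHom = pauliSubgroup L := by
    have hconj : ∀ (P : QubitUnitary n) (u : PhaseSpace n), ProjEq P.1 (pauli u) →
        ProjEq (U * P * U⁻¹).1 (conjPauli U u) := fun P u hP =>
      ((ProjEq.refl U.1).mul hP).mul (ProjEq.refl (star U.1))
    have hpow : ∀ V P : QubitUnitary n, P ^ 4 = 1 → (V * P * V⁻¹) ^ 4 = 1 := by
      intro V P hP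
      rw [conj_pow, hP, mul_one, mul_inv_cancel]
    ext Q
    simp only [Subgroup.mem_map, MulEquiv.coe_toMonoidHom, MulAut.conj_apply]
    constructor
    · rintro ⟨P, ⟨hP, u, hu, hPu⟩, rfl⟩
      obtain ⟨x, hx, hux⟩ := (hM u).1 hu
      have hx' := (hconj P u hPu).trans hux
      exact ⟨mem_pauliGroup_iff.2 ⟨hpow U P (mem_pauliGroup_iff.1 hP).1, x, hx'⟩, x, hx, hx'⟩
    · rintro ⟨hQ, x, hx, hQx⟩
      obtain ⟨u, hu⟩ := h x hx
      have hu' : ProjEq (U⁻¹ * Q * U).1 (pauli u) := by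
        have h1 := ((ProjEq.refl (star U.1)).mul (hQx.trans hu.symm)).mul (ProjEq.refl U.1)
        have hUU' : star U.1 * U.1 = 1 := Matrix.mem_unitaryGroup_iff'.1 U.2
        have h2 : star U.1 * conjPauli U u * U.1 = pauli u := by
          rw [conjPauli, ← mul_assoc, ← mul_assoc, hUU', one_mul, mul_assoc, hUU', mul_one]
        rwa [h2] at h1
      have h4 : (U⁻¹ * Q * U) ^ 4 = 1 := by
        simpa using hpow U⁻¹ Q (mem_pauliGroup_iff.1 hQ).1
      exact ⟨U⁻¹ * Q * U, ⟨mem_pauliGroup_iff.2 ⟨h4, u, hu'⟩, u, (hM u).2 ⟨x, hx, hu⟩, hu'⟩,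
        by group⟩
  rw [hmap]
  exact isMaximalAbelianPauli_pauliSubgroup hL

end QubitPauli

open QubitPauli IsPhaseSpaceAction in
theorem theorem2 (U : QubitUnitary 3) (hU : U ∈ cliffordHierarchy 3 3) :
    IsSemiClifford U := by
  obtain ⟨S, hS⟩ := exists_isPhaseSpaceAction hU
  -- The span of the ranges of the nilpotent parts is isotropic, because their products vanish.
  have hiso : (⨆ v, (nilpotentPart S v).range) ≤
      (symplecticForm 3).orthogonal (⨆ v, (nilpotentPart S v).range) := by
    refine iSup_le fun v => ?_
    rintro _ ⟨x, rfl⟩ r hr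
    induction hr using Submodule.iSup_induction' with
    | mem w r hr =>
      obtain ⟨y, rfl⟩ := hr
      rw [hS.symplecticForm_nilpotentPart, hS.nilpotentPart_nilpotentPart_eq_zero, map_zero]
    | zero => rw [map_zero, LinearMap.zero_apply]
    | add r s _ _ hr hs => rw [map_add, LinearMap.add_apply, hr, hs, add_zero]
  obtain ⟨L, hRL, hL⟩ := exists_orthogonal_eq_self _ (symplecticForm_isAlt 3) _ hiso
  refine isSemiClifford_of_lagrangian hL fun x hx => hS.exists_projEq_of_forall_apply_eq fun v => ?_
  -- A vector orthogonal to all the ranges is fixed by the whole action.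
  rw [← nilpotentPart_eq_zero_iff]
  refine eq_zero_of_symplecticForm_eq_zero _ fun y => ?_
  rw [← hL] at hx
  rw [hS.symplecticForm_nilpotentPart, symplecticForm_symm]
  exact hx _ (hRL (Submodule.mem_iSup_of_mem v ⟨y, rfl⟩))
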